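/- Let $\Bbbk$ be a field of characteristic zero, let $n\ge 4$ and $S=\Bbbk[x_1,\dots,x_n]$ with the standard grading. Write $\mathrm{HF}(S,i)=\dim_{\Bbbk}S_i$ and $\Delta(n,2)=\mathrm{HF}(S,2)-\mathrm{HF}(S,1)=\binom n2$. Let $\Omega_n$ be the following set of integers (all intervals are intervals of integers): $$\Omega_n=\begin{cases}[6,\Delta(4,2)] & n=4,\\ [9,\Delta(5,2)] & n=5,\\ [8,\Delta(6,2)]\setminus\{10\} & n=6,\\ [n+3,\Delta(n,2)] & n\ge 7 \text{ odd},\\ [n+2,\Delta(n,2)] & n\ge 8\text{ even}.\end{cases}$$ Then for every $\mu\in\Omega_n$ there is a monomial ideal $I\subset S$, minimally generated by $\mu$ monomials of degree $2$, such that $A=S/I$ is artinian and fails the weak Lefschetz property; that is, there is no linear form $\ell\in A_1$ such that for every $i\ge 0$ the multiplication map $\times\ell\colon A_i\to A_{i+1}$ is injective or surjective. -/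

import Mathlib

open MvPolynomial

noncomputable section

/-- The `i`-th graded piece `A_i` of `A = k[x_1, …, x_n] / I`, for the standard grading:
the classes of the forms of degree `i`. -/
def gradedPiece {n : ℕ} {k : Type*} [Field k] (I : Ideal (MvPolynomial (Fin n) k)) (i : ℕ) :
    Submodule k (MvPolynomial (Fin n) k ⧸ I) :=
  (homogeneousSubmodule (Fin n) k i).map (Ideal.Quotient.mkₐ k I).toLinearMap

/-- The weak Lefschetz property of `A = k[x_1, …, x_n] / I` (for a homogeneous ideal `I`): there is
a linear form `ℓ` in `A` such that, for every `i`, the multiplication map `ℓ : A_i → A_{i+1}` has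
maximal rank, i.e. is injective or surjective. -/
def HasWLP {n : ℕ} {k : Type*} [Field k] (I : Ideal (MvPolynomial (Fin n) k)) : Prop :=
  ∃ ℓ ∈ gradedPiece I 1, ∀ i : ℕ,
    Set.InjOn (fun a => ℓ * a) (gradedPiece I i : Set (MvPolynomial (Fin n) k ⧸ I)) ∨
    Set.SurjOn (fun a => ℓ * a) (gradedPiece I i : Set (MvPolynomial (Fin n) k ⧸ I))
      (gradedPiece I (i + 1) : Set (MvPolynomial (Fin n) k ⧸ I))

/-- The ideal generated by the monomials `x^e` with exponent vector `e` in `E`. -/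
def monomialIdeal {n : ℕ} (k : Type*) [Field k] (E : Set (Fin n →₀ ℕ)) :
    Ideal (MvPolynomial (Fin n) k) :=
  Ideal.span ((fun e => monomial e (1 : k)) '' E)

/-- `I` is minimally generated by `μ` monomials of degree `d`: it is generated by a set of `μ`
monomials of degree `d`, and by no proper subset of that set. -/
def IsMinimallyGeneratedByMonomials {n : ℕ} {k : Type*} [Field k]
    (I : Ideal (MvPolynomial (Fin n) k)) (d μ : ℕ) : Prop :=
  ∃ E : Finset (Fin n →₀ ℕ), (∀ e ∈ E, e.degree = d) ∧ E.card = μ ∧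
    monomialIdeal k (E : Set (Fin n →₀ ℕ)) = I ∧
    ∀ F : Finset (Fin n →₀ ℕ), F ⊂ E → monomialIdeal k (F : Set (Fin n →₀ ℕ)) ≠ I

/-- The Hilbert function of the polynomial ring `S = k[x_1, …, x_n]`. -/
def hilbertS (k : Type*) [Field k] (n i : ℕ) : ℕ :=
  Module.finrank k (homogeneousSubmodule (Fin n) k i)

/-- `Δ(n, d) = HF(S, d) - HF(S, d - 1)`, an integer (used for `d ≥ 1` only). -/
def Delta (k : Type*) [Field k] (n d : ℕ) : ℤ :=
  (hilbertS k n d : ℤ) - (hilbertS k n (d - 1) : ℤ)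

/-- The set `Ω_n` of numbers of generators (used for `n ≥ 4` only). -/
def Omega (k : Type*) [Field k] (n : ℕ) : Set ℕ :=
  if n = 4 then {μ | 6 ≤ μ ∧ (μ : ℤ) ≤ Delta k 4 2}
  else if n = 5 then {μ | 9 ≤ μ ∧ (μ : ℤ) ≤ Delta k 5 2}
  else if n = 6 then {μ | 8 ≤ μ ∧ (μ : ℤ) ≤ Delta k 6 2} \ {10}
  else if 7 ≤ n ∧ Odd n then {μ | n + 3 ≤ μ ∧ (μ : ℤ) ≤ Delta k n 2}
  else if 8 ≤ n ∧ Even n then {μ | n + 2 ≤ μ ∧ (μ : ℤ) ≤ Delta k n 2}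
  else ∅

end

/-!
Everything happens with ideals generated by the squares `x_i ^ 2` and some squarefree quadrics
`x_i x_j`, i.e. with a graph on the vertices `0, …, n - 1`. Such an ideal is encoded by the finite set
`D` of unordered pairs `{i, j}` with `x_i x_j` among the generators, so the number of generators is
`|D|` and the squares correspond to the diagonal of `Sym2 (Fin n)`.

For suitable `D` and `d`, multiplication by *every* linear form `ℓ = ∑ a_i x_i` fails both to be
injective and to be surjective from degree `d` to degree `d + 1`.

* Injectivity: suppose the vertices are partitioned into `d` blocks such that all pairs of `D` lie
  inside blocks, and let `ℓ_β` be the part of `ℓ` on the block `β`. If each block carries a nonzero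
  linear form `p_β` with `ℓ_β p_β = 0` in the quotient, then `∏ p_β` is killed by `ℓ`. The form `p_β`
  exists when the non-edges within the block have a bipartite component `T`: change the signs of the
  coefficients of `ℓ` on one side of `T`, and set all coefficients off `T` to zero.
* Surjectivity: suppose there are `d + 1` disjoint pairs of vertices such that the elements of `D` on
  these `2 (d + 1)` vertices lie inside pairs. Send the two variables of the `j`-th pair to multiples
  of a new variable `y_j` chosen such that `ℓ` goes to `0`, and all other variables to `0`. This
  defines a map from the quotient to `k[y] / (y_0 ^ 2, …, y_d ^ 2)` killing the image of `ℓ`, but not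
  everything in degree `d + 1`.

Both `∏ p_β ≠ 0` and the last claim reduce, through a specialisation of the variables, to
`∏ y_j ∉ (y_0 ^ 2, …, y_d ^ 2)`. The resulting criterion is `not_hasWLP_of_blocks`. Three families of
graphs satisfy it and realise all numbers of generators in question: matchings with few edges
(`exists_of_matching`), stars (`exists_of_star`), and graphs with a vertex joined to all others
whose complement contains a 4-cycle (`exists_of_cone`).
-/

/-! ### Quadratic monomial ideals attached to sets of pairs -/

/-- The exponent vector of the monomial `x_i x_j`, for an unordered pair `{i, j}`. -/
noncomputable def quadExp {n : ℕ} : Sym2 (Fin n) → (Fin n →₀ ℕ) :=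
  Sym2.lift ⟨fun i j => Finsupp.single i 1 + Finsupp.single j 1, fun _ _ => add_comm _ _⟩

@[simp]
lemma quadExp_mk {n : ℕ} (i j : Fin n) :
    quadExp s(i, j) = Finsupp.single i 1 + Finsupp.single j 1 := rfl

lemma quadExp_injective {n : ℕ} : Function.Injective (quadExp (n := n)) := by
  intro e f h
  induction e with | _ a b
  induction f with | _ c d
  rw [quadExp_mk, quadExp_mk, Finsupp.single_add_single_eq_single_add_single one_ne_zero
    one_ne_zero] at h
  rw [Sym2.eq_iff]
  simpa using h

lemma degree_quadExp {n : ℕ} (e : Sym2 (Fin n)) : (quadExp e).degree = 2 := by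
  induction e with | _ a b
  simp [map_add]

/-- The ideal generated by the monomials `x_i x_j` with `{i, j} ∈ D`. -/
noncomputable abbrev quadIdeal {n : ℕ} (k : Type*) [Field k] (D : Finset (Sym2 (Fin n))) :
    Ideal (MvPolynomial (Fin n) k) :=
  monomialIdeal k (D.image quadExp : Finset (Fin n →₀ ℕ))

/-- The ideal `(y_0 ^ 2, …, y_{m - 1} ^ 2)` of `k[y_0, …, y_{m - 1}]`. -/
noncomputable abbrev squaresIdeal (k : Type*) [Field k] (m : ℕ) : Ideal (MvPolynomial (Fin m) k) :=
  monomialIdeal k (Set.range fun j => Finsupp.single j 2)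

section
variable {n : ℕ} {k : Type*} [Field k]

lemma X_mul_X_mem {D : Finset (Sym2 (Fin n))} {i j : Fin n} (h : s(i, j) ∈ D) :
    (X i * X j : MvPolynomial (Fin n) k) ∈ quadIdeal k D := by
  have : (X i * X j : MvPolynomial (Fin n) k) = monomial (quadExp s(i, j)) 1 := by
    simp [X, monomial_mul]
  rw [this]
  exact Ideal.subset_span ⟨_, by simpa using ⟨_, h, rfl⟩, rfl⟩

lemma isMinimallyGenerated_quadIdeal (D : Finset (Sym2 (Fin n))) :
    IsMinimallyGeneratedByMonomials (quadIdeal k D) 2 D.card := by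
  refine ⟨D.image quadExp, ?_, Finset.card_image_of_injective _ quadExp_injective, rfl, ?_⟩
  · intro e he
    obtain ⟨s, -, rfl⟩ := Finset.mem_image.1 he
    exact degree_quadExp s
  · intro F hF heq
    obtain ⟨hsub, hne⟩ := Finset.ssubset_iff_subset_ne.1 hF
    refine hne (Finset.Subset.antisymm hsub fun e he => ?_)
    have hmem : monomial e (1 : k) ∈ monomialIdeal k (F : Set (Fin n →₀ ℕ)) := by
      rw [heq]
      exact Ideal.subset_span ⟨e, he, rfl⟩
    obtain ⟨f, hf, hle⟩ := mem_ideal_span_monomial_image.1 hmem e (by simp [mem_support_iff])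
    have hdeg : ∀ g ∈ D.image (quadExp (n := n)), g.degree = 2 := by
      intro g hg
      obtain ⟨s, -, rfl⟩ := Finset.mem_image.1 hg
      exact degree_quadExp s
    -- a divisor of the same degree is equal
    obtain ⟨c, rfl⟩ := exists_add_of_le hle
    have h1 := hdeg _ he
    have h2 := hdeg _ (hsub hf)
    have hc : c.degree = 0 := by
      rw [map_add] at h1; omega
    rw [Finsupp.degree_eq_zero_iff] at hc
    simpa [hc] using hf

lemma isArtinianRing_quotient_quadIdeal {D : Finset (Sym2 (Fin n))} (hD : ∀ i, s(i, i) ∈ D) :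
    IsArtinianRing (MvPolynomial (Fin n) k ⧸ quadIdeal k D) := by
  set A := MvPolynomial (Fin n) k ⧸ quadIdeal k D
  have hint : Algebra.IsIntegral k A := by
    refine ⟨fun a => ?_⟩
    obtain ⟨f, rfl⟩ := Ideal.Quotient.mk_surjective a
    induction f using MvPolynomial.induction_on with
    | C c => exact isIntegral_algebraMap (R := k) (A := A) (x := c)
    | add p q hp hq => rw [map_add]; exact hp.add hq
    | mul_X p i hp =>
      rw [map_mul]
      refine hp.mul (IsIntegral.of_pow (n := 2) two_pos ?_)
      rw [← map_pow, Ideal.Quotient.eq_zero_iff_mem.2]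
      · exact isIntegral_zero
      · rw [pow_two]; exact X_mul_X_mem (hD i)
  have : Module.Finite k A := Algebra.IsIntegral.finite
  exact IsArtinianRing.of_finite k A

/-! ### Specialisation to the algebra of squares -/

/-- The `k`-algebra homomorphism `x_i ↦ θ_i y_{q i}`. -/
noncomputable def scaledSpecialization {m : ℕ} (θ : Fin n → k) (q : Fin n → Fin m) :
    MvPolynomial (Fin n) k →ₐ[k] MvPolynomial (Fin m) k :=
  aeval fun i => C (θ i) * X (q i)

@[simp]
lemma scaledSpecialization_X {m : ℕ} (θ : Fin n → k) (q : Fin n → Fin m) (i : Fin n) :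
    scaledSpecialization θ q (X i) = C (θ i) * X (q i) := by
  simp [scaledSpecialization]

@[simp]
lemma scaledSpecialization_C {m : ℕ} (θ : Fin n → k) (q : Fin n → Fin m) (x : k) :
    scaledSpecialization θ q (C x) = C x := by
  simp [scaledSpecialization]

/-- A specialisation sends `x_i x_j` to a multiple of a square as soon as `i` and `j` go to the same
variable, and to `0` if one of the two scalars vanishes. -/
lemma scaledSpecialization_mem {m : ℕ} {θ : Fin n → k} {q : Fin n → Fin m}
    {D : Finset (Sym2 (Fin n))}
    (h : ∀ i j, s(i, j) ∈ D → θ i ≠ 0 → θ j ≠ 0 → q i = q j)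
    {f : MvPolynomial (Fin n) k} (hf : f ∈ quadIdeal k D) :
    scaledSpecialization θ q f ∈ squaresIdeal k m := by
  suffices quadIdeal k D ≤ (squaresIdeal k m).comap (scaledSpecialization θ q) from this hf
  refine Ideal.span_le.2 ?_
  rintro _ ⟨e, he, rfl⟩
  obtain ⟨s, hs, rfl⟩ := Finset.mem_image.1 (Finset.mem_coe.1 he)
  induction s with | _ i j
  have hX : (monomial (quadExp s(i, j)) 1 : MvPolynomial (Fin n) k) = X i * X j := by
    simp [X, monomial_mul]
  simp only [hX, SetLike.mem_coe, Ideal.mem_comap, map_mul, scaledSpecialization_X]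
  by_cases hi : θ i = 0
  · simp [hi]
  by_cases hj : θ j = 0
  · simp [hj]
  have hsq : (X (q i) ^ 2 : MvPolynomial (Fin m) k) ∈ squaresIdeal k m :=
    Ideal.subset_span ⟨_, ⟨q i, rfl⟩, (X_pow_eq_monomial).symm⟩
  have : (C (θ i) * X (q i) * (C (θ j) * X (q j)) : MvPolynomial (Fin m) k)
      = C (θ i * θ j) * X (q i) ^ 2 := by
    rw [← h i j hs hi hj, C_mul]; ring
  rw [this]
  exact Ideal.mul_mem_left _ _ hsq

lemma prod_C_mul_X_notMem {m : ℕ} {c : Fin m → k} (hc : ∀ j, c j ≠ 0) :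
    (∏ j, C (c j) * X j : MvPolynomial (Fin m) k) ∉ squaresIdeal k m := by
  intro h
  have hmon : (∏ j, C (c j) * X j : MvPolynomial (Fin m) k)
      = monomial (∑ j, Finsupp.single j 1) (∏ j, c j) := by
    rw [monomial_sum_prod]
    exact Finset.prod_congr rfl fun j _ => C_mul_X_eq_monomial
  rw [hmon] at h
  obtain ⟨_, ⟨j, rfl⟩, hle⟩ := mem_ideal_span_monomial_image.1 h (∑ j, Finsupp.single j 1) (by
    simp [mem_support_iff, Finset.prod_ne_zero_iff, hc])
  have := hle j
  simp [Finsupp.finsetSum_apply, Finsupp.single_apply] at this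

end

/-! ### Failure of maximal rank -/

section
variable {n : ℕ} {k : Type*} [Field k]

lemma exists_eq_sum_of_isHomogeneous_one {L : MvPolynomial (Fin n) k} (hL : L.IsHomogeneous 1) :
    ∃ a : Fin n → k, L = ∑ i, C (a i) * X i := by
  rw [← mem_homogeneousSubmodule, homogeneousSubmodule_one_eq_span_X,
    Submodule.mem_span_range_iff_exists_fun] at hL
  obtain ⟨a, rfl⟩ := hL
  exact ⟨a, by simp [smul_eq_C_mul]⟩

/-- In `(∑ a_i x_i) (∑ c_j x_j)` the coefficient of `x_i x_j` is `a_i c_j + a_j c_i` for `i ≠ j`. To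
treat all pairs uniformly, twice the product is rewritten as a sum over ordered pairs, which is why
`2` has to be invertible. -/
lemma sum_mul_sum_mem [NeZero (2 : k)] {D : Finset (Sym2 (Fin n))} {a c : Fin n → k}
    (s : Finset (Fin n))
    (h : ∀ i ∈ s, ∀ j ∈ s, s(i, j) ∉ D → c i * a j + c j * a i = 0) :
    (∑ i ∈ s, C (a i) * X i) * ∑ j ∈ s, C (c j) * X j ∈ quadIdeal k D := by
  set S := (∑ i ∈ s, C (a i) * X i) * ∑ j ∈ s, C (c j) * X j with hS
  have h1 : S = ∑ i ∈ s, ∑ j ∈ s, C (a i * c j) * (X i * X j) := by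
    rw [hS, Finset.sum_mul_sum]
    refine Finset.sum_congr rfl fun i _ => Finset.sum_congr rfl fun j _ => ?_
    rw [C_mul]; ring
  have h2 : S + S = ∑ i ∈ s, ∑ j ∈ s, C (c i * a j + c j * a i) * (X i * X j) := by
    have h1' : S = ∑ i ∈ s, ∑ j ∈ s, C (a j * c i) * (X j * X i) := by rw [h1, Finset.sum_comm]
    rw [congrArg₂ (· + ·) h1 h1', ← Finset.sum_add_distrib]
    refine Finset.sum_congr rfl fun i _ => ?_
    rw [← Finset.sum_add_distrib]
    refine Finset.sum_congr rfl fun j _ => ?_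
    simp only [C_mul, C_add]; ring
  have h3 : S + S ∈ quadIdeal k D := by
    rw [h2]
    refine Ideal.sum_mem _ fun i hi => Ideal.sum_mem _ fun j hj => ?_
    by_cases hij : s(i, j) ∈ D
    · exact Ideal.mul_mem_left _ _ (X_mul_X_mem hij)
    · simp [h i hi j hj hij]
  have h4 : S = C (2⁻¹ : k) * (S + S) := by
    rw [← two_mul, ← mul_assoc, show (2 : MvPolynomial (Fin n) k) = C 2 from (map_ofNat C 2).symm,
      ← C_mul, inv_mul_cancel₀ (NeZero.ne (2 : k)), C_1, one_mul]
  rw [h4]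
  exact Ideal.mul_mem_left _ _ h3

/-- If on each block `∑ c_i x_i` is killed by the part of `∑ a_i x_i` supported there, the product
over all blocks is killed by `∑ a_i x_i`. -/
lemma sum_mul_prod_mem [NeZero (2 : k)] {d : ℕ} {D : Finset (Sym2 (Fin n))} {a c : Fin n → k}
    {b : Fin n → Fin d}
    (hc : ∀ i j, b i = b j → s(i, j) ∉ D → c i * a j + c j * a i = 0) :
    (∑ i, C (a i) * X i) * ∏ β, ∑ i with b i = β, C (c i) * X i ∈ quadIdeal k D := by
  rw [← Finset.sum_fiberwise (s := Finset.univ) (g := b), Finset.sum_mul]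
  refine Ideal.sum_mem _ fun β _ => ?_
  rw [← Finset.mul_prod_erase _ _ (Finset.mem_univ β), ← mul_assoc]
  refine Ideal.mul_mem_right _ _ (sum_mul_sum_mem _ fun i hi j hj hij => hc i j ?_ hij)
  simp only [Finset.mem_filter, Finset.mem_univ, true_and] at hi hj
  rw [hi, hj]

lemma prod_notMem {d : ℕ} {D : Finset (Sym2 (Fin n))} {c : Fin n → k} {b : Fin n → Fin d}
    (hb : ∀ i j, s(i, j) ∈ D → b i = b j) (hc : ∀ β, ∃ i, b i = β ∧ c i ≠ 0) :
    (∏ β, ∑ i with b i = β, C (c i) * X i : MvPolynomial (Fin n) k) ∉ quadIdeal k D := by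
  choose v hv hcv using hc
  intro h
  -- keep one variable with nonzero coefficient in each block and kill all the others
  have h1 := scaledSpecialization_mem (θ := fun i => if i = v (b i) then (1 : k) else 0) (q := b)
    (fun i j hij _ _ => hb i j hij) h
  refine prod_C_mul_X_notMem hcv ?_
  convert h1 using 1
  rw [map_prod]
  refine Finset.prod_congr rfl fun β _ => ?_
  rw [map_sum, Finset.sum_eq_single (v β)]
  · simp [hv]
  · intro i hi hne
    simp only [Finset.mem_filter, Finset.mem_univ, true_and] at hi
    simp [hi, hne]
  · intro hne
    simp [hv] at hne

/-- Failure of the weak Lefschetz property in degree `d`: for every coefficient vector `a` of a linear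
form, `c` gives an element of its kernel in degree `d`, and the specialisation `x_i ↦ θ_i y_{q i}`
shows that its image in degree `d + 1` is proper. -/
theorem not_hasWLP_of_blocks_of_pairs [NeZero (2 : k)] {D : Finset (Sym2 (Fin n))} {d : ℕ}
    (b : Fin n → Fin d) (hb : ∀ i j, s(i, j) ∈ D → b i = b j)
    (hker : ∀ a : Fin n → k, ∃ c : Fin n → k,
      (∀ i j, b i = b j → s(i, j) ∉ D → c i * a j + c j * a i = 0) ∧
      ∀ β, ∃ i, b i = β ∧ c i ≠ 0)
    (hcok : ∀ a : Fin n → k, ∃ (θ : Fin n → k) (q : Fin n → Fin (d + 1)),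
      (∀ i j, s(i, j) ∈ D → θ i ≠ 0 → θ j ≠ 0 → q i = q j) ∧
      (∀ j, ∑ i with q i = j, a i * θ i = 0) ∧ ∀ j, ∃ i, q i = j ∧ θ i ≠ 0) :
    ¬ HasWLP (quadIdeal k D) := by
  rintro ⟨_, ⟨L, hL, rfl⟩, hmax⟩
  obtain ⟨a, rfl⟩ := exists_eq_sum_of_isHomogeneous_one hL
  rcases hmax d with hinj | hsurj
  · obtain ⟨c, hc, hne⟩ := hker a
    refine prod_notMem hb hne (Ideal.Quotient.eq_zero_iff_mem.1 ?_)
    refine hinj (x₁ := Ideal.Quotient.mk _ (∏ β, ∑ i with b i = β, C (c i) * X i)) (x₂ := 0)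
      ⟨_, ?_, rfl⟩ (Submodule.zero_mem _) ?_
    · have := IsHomogeneous.prod Finset.univ
        (fun β => ∑ i with b i = β, C (c i) * X i : Fin d → MvPolynomial (Fin n) k) (fun _ => 1)
        (fun β _ => IsHomogeneous.sum _ _ _ fun i _ => isHomogeneous_C_mul_X _ _)
      simpa using this
    · simp only [mul_zero]
      exact Ideal.Quotient.eq_zero_iff_mem.2 (sum_mul_prod_mem hc)
  · obtain ⟨θ, q, hq, hsum, hne⟩ := hcok a
    choose v hv hθ using hne
    have hmem : Ideal.Quotient.mk (quadIdeal k D) (∏ j, X (v j)) ∈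
        (gradedPiece (quadIdeal k D) (d + 1) : Set _) := by
      refine ⟨_, ?_, rfl⟩
      have := IsHomogeneous.prod Finset.univ
        (fun j => X (v j) : Fin (d + 1) → MvPolynomial (Fin n) k) (fun _ => 1)
        (fun j _ => isHomogeneous_X _ _)
      simpa using this
    obtain ⟨_, ⟨f, -, rfl⟩, hf⟩ := hsurj hmem
    have hdiff : (∑ i, C (a i) * X i) * f - ∏ j, X (v j) ∈ quadIdeal k D :=
      Ideal.Quotient.eq.1 hf
    have himg := scaledSpecialization_mem hq hdiff
    have hzero : scaledSpecialization θ q (∑ i, C (a i) * X i) = 0 := by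
      rw [← Finset.sum_fiberwise (s := Finset.univ) (g := q), map_sum]
      refine Finset.sum_eq_zero fun j _ => ?_
      have : ∀ i ∈ Finset.univ.filter (q · = j), scaledSpecialization θ q (C (a i) * X i)
          = C (a i * θ i) * X j := by
        intro i hi
        simp only [Finset.mem_filter, Finset.mem_univ, true_and] at hi
        rw [map_mul, scaledSpecialization_X, scaledSpecialization_C, hi, C_mul, mul_assoc]
      rw [map_sum, Finset.sum_congr rfl this, ← Finset.sum_mul, ← map_sum, hsum, C_0, zero_mul]
    rw [map_sub, map_mul, hzero, zero_mul, zero_sub, neg_mem_iff, map_prod] at himg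
    refine prod_C_mul_X_notMem hθ ?_
    simpa [hv] using himg

/-- Annihilating forms on blocks: within each block, the non-edges meeting `T` stay inside `T` and
join vertices with different values of `σ`. On `T` one takes `c = ± a` according to `σ`; on a block
where `a` vanishes on `T` this would be zero, but then any coefficients supported on `T` do. -/
lemma exists_block_coeffs {d : ℕ} {D : Finset (Sym2 (Fin n))} (b : Fin n → Fin d)
    (T : Set (Fin n)) (σ : Fin n → Bool)
    (hT : ∀ i j, i ∈ T → b i = b j → s(i, j) ∉ D → j ∈ T ∧ σ i ≠ σ j)
    (hne : ∀ β, ∃ i ∈ T, b i = β) (a : Fin n → k) :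
    ∃ c : Fin n → k, (∀ i j, b i = b j → s(i, j) ∉ D → c i * a j + c j * a i = 0) ∧
      ∀ β, ∃ i, b i = β ∧ c i ≠ 0 := by
  classical
  refine ⟨fun i => if i ∈ T then
    (if ∃ j ∈ T, b j = b i ∧ a j ≠ 0 then (if σ i then a i else - a i) else 1) else 0, ?_, ?_⟩
  · intro i j hij hD
    by_cases hi : i ∈ T
    · obtain ⟨hj, hσ⟩ := hT i j hi hij hD
      by_cases hex : ∃ l ∈ T, b l = b j ∧ a l ≠ 0
      · simp only [hi, hj, hij, hex, if_true]
        cases h1 : σ i <;> cases h2 : σ j <;> simp_all <;> ring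
      · simp only [hi, hj, hij, hex, if_true, if_false]
        push Not at hex
        simp [hex i hi hij, hex j hj rfl]
    · have hj : j ∉ T := fun hj => hi (hT j i hj hij.symm (by rwa [Sym2.eq_swap])).1
      simp [hi, hj]
  · intro β
    by_cases hex : ∃ j ∈ T, b j = β ∧ a j ≠ 0
    · obtain ⟨j, hj, hjb, haj⟩ := hex
      refine ⟨j, hjb, ?_⟩
      dsimp only
      rw [if_pos hj, if_pos ⟨j, hj, rfl, haj⟩]
      split_ifs <;> simpa
    · obtain ⟨i, hi, rfl⟩ := hne β
      exact ⟨i, rfl, by simp [hi, hex]⟩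

/-- The pairs are `{2 j, 2 j + 1}` for `j ≤ d`; the scalars `θ` are supported on them and orthogonal
to `a` on each of them. -/
lemma exists_pair_coeffs {d : ℕ} {D : Finset (Sym2 (Fin n))} (hd : 2 * (d + 1) ≤ n)
    (hD : ∀ i j : Fin n, s(i, j) ∈ D → i.1 < 2 * (d + 1) → j.1 < 2 * (d + 1) →
      i.1 / 2 = j.1 / 2) (a : Fin n → k) :
    ∃ (θ : Fin n → k) (q : Fin n → Fin (d + 1)),
      (∀ i j, s(i, j) ∈ D → θ i ≠ 0 → θ j ≠ 0 → q i = q j) ∧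
      (∀ j, ∑ i with q i = j, a i * θ i = 0) ∧ ∀ j, ∃ i, q i = j ∧ θ i ≠ 0 := by
  classical
  have hpair : ∀ x y : k, ∃ α β : k, x * α + y * β = 0 ∧ (α ≠ 0 ∨ β ≠ 0) := by
    intro x y
    by_cases hx : x = 0
    · exact ⟨1, 0, by simp [hx], by simp⟩
    · exact ⟨y, -x, by ring, by simp [hx]⟩
  let u : Fin (d + 1) → Fin n := fun j => ⟨2 * j.1, by omega⟩
  let v : Fin (d + 1) → Fin n := fun j => ⟨2 * j.1 + 1, by omega⟩
  choose α β hαβ hne using fun j => hpair (a (u j)) (a (v j))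
  let q : Fin n → Fin (d + 1) := fun i => if h : i.1 / 2 < d + 1 then ⟨i.1 / 2, h⟩ else 0
  let θ : Fin n → k := fun i => if i.1 < 2 * (d + 1) then
    (if i.1 % 2 = 0 then α (q i) else β (q i)) else 0
  have hlt : ∀ i, θ i ≠ 0 → i.1 < 2 * (d + 1) := by
    intro i hi
    by_contra hlt
    exact hi (if_neg hlt)
  have hqu : ∀ j, q (u j) = j := fun j => by
    have h1 : (2 * j.1) / 2 = j.1 := by omega
    simp only [q, u, h1, j.2, dif_pos]
  have hqv : ∀ j, q (v j) = j := fun j => by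
    have h1 : (2 * j.1 + 1) / 2 = j.1 := by omega
    simp only [q, v, h1, j.2, dif_pos]
  have hθu : ∀ j, θ (u j) = α j := fun j => by
    have : 2 * j.1 < 2 * (d + 1) := by omega
    simp only [θ, hqu]
    simp [u, this]
  have hθv : ∀ j, θ (v j) = β j := fun j => by
    have : 2 * j.1 + 1 < 2 * (d + 1) := by omega
    have h2 : (2 * j.1 + 1) % 2 ≠ 0 := by omega
    simp only [θ, hqv]
    simp [v, this]
  refine ⟨θ, q, fun i j hij hi hj => ?_, fun j => ?_, fun j => ?_⟩
  · have := hD i j hij (hlt i hi) (hlt j hj)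
    simp [q, this]
  · have huv : u j ≠ v j := by simp [u, v]
    rw [← hαβ j, ← hθu j, ← hθv j, ← Finset.sum_pair (f := fun i => a i * θ i) huv]
    symm
    refine Finset.sum_subset ?_ ?_
    · intro i hi
      simp only [Finset.mem_insert, Finset.mem_singleton] at hi
      rcases hi with rfl | rfl <;> simp [hqu, hqv]
    · intro i hi hni
      by_contra hne0
      have hi' := hlt i (right_ne_zero_of_mul hne0)
      have hdiv : i.1 / 2 < d + 1 := by omega
      simp only [Finset.mem_filter, Finset.mem_univ, true_and, q, dif_pos hdiv] at hi
      have hj : i.1 / 2 = j.1 := congrArg Fin.val hi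
      apply hni
      simp only [Finset.mem_insert, Finset.mem_singleton, u, v, Fin.ext_iff]
      omega
  · rcases hne j with h | h
    · exact ⟨u j, hqu j, by rwa [hθu]⟩
    · exact ⟨v j, hqv j, by rwa [hθv]⟩

/-- Combinatorial criterion for the failure of the weak Lefschetz property in degree `d`. The
partition `b` into `d` blocks, with the union `T` of bipartite components of the non-edges within
blocks and their bipartition `σ`, gives non-injectivity; the pairs `{2 j, 2 j + 1}`, `j ≤ d`, give
non-surjectivity. -/
theorem not_hasWLP_of_blocks [NeZero (2 : k)] {D : Finset (Sym2 (Fin n))} {d : ℕ}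
    (b : Fin n → Fin d) (hb : ∀ i j, s(i, j) ∈ D → b i = b j)
    (T : Set (Fin n)) (σ : Fin n → Bool)
    (hT : ∀ i j, i ∈ T → b i = b j → s(i, j) ∉ D → j ∈ T ∧ σ i ≠ σ j)
    (hne : ∀ β, ∃ i ∈ T, b i = β) (hd : 2 * (d + 1) ≤ n)
    (hD : ∀ i j : Fin n, s(i, j) ∈ D → i.1 < 2 * (d + 1) → j.1 < 2 * (d + 1) →
      i.1 / 2 = j.1 / 2) :
    ¬ HasWLP (quadIdeal k D) :=
  not_hasWLP_of_blocks_of_pairs b hb (exists_block_coeffs b T σ hT hne)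
    (exists_pair_coeffs hd hD)

end

/-! ### The upper bound for the number of generators -/

section
variable {n : ℕ} {k : Type*} [Field k]

lemma hilbertS_one : hilbertS k n 1 = n := by
  rw [hilbertS, homogeneousSubmodule_one_eq_span_X,
    finrank_span_eq_card (linearIndependent_X (Fin n) k), Fintype.card_fin]

lemma hilbertS_two_le : hilbertS k n 2 ≤ (n + 1).choose 2 := by
  have hspan : homogeneousSubmodule (Fin n) k 2
      = Submodule.span k (Set.range fun e : Sym2 (Fin n) => monomial (quadExp e) (1 : k)) := by
    rw [← homogeneousSubmodule_one_pow, pow_two, homogeneousSubmodule_one_eq_span_X,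
      Submodule.span_mul_span]
    congr 1
    ext f
    simp only [Set.mem_mul, Set.mem_range, exists_exists_eq_and]
    constructor
    · rintro ⟨i, j, rfl⟩
      exact ⟨s(i, j), by simp [X, monomial_mul]⟩
    · rintro ⟨e, rfl⟩
      induction e with | _ i j
      exact ⟨i, j, by simp [X, monomial_mul]⟩
  rw [hilbertS, hspan]
  refine (finrank_range_le_card _).trans_eq ?_
  rw [Sym2.card, Fintype.card_fin]

lemma Delta_two_le : Delta k n 2 ≤ n.choose 2 := by
  have h1 := hilbertS_two_le (k := k) (n := n)
  have h2 : (n + 1).choose 2 = n + n.choose 2 := by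
    rw [Nat.choose_succ_succ' n 1, Nat.choose_one_right]
  simp only [Delta, Nat.reduceSub, hilbertS_one]
  omega

/-! ### Three families of graphs -/

/-- The diagonal together with the pairs `{x t, y t}`. -/
def diagUnion {r : ℕ} (x y : Fin r → Fin n) : Finset (Sym2 (Fin n)) :=
  Finset.univ.image (fun i => s(i, i)) ∪ Finset.univ.image fun t => s(x t, y t)

lemma mk_mem_diagUnion {r : ℕ} {x y : Fin r → Fin n} {i j : Fin n} :
    s(i, j) ∈ diagUnion x y ↔ i = j ∨ ∃ t, x t = i ∧ y t = j ∨ x t = j ∧ y t = i := by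
  simp only [diagUnion, Finset.mem_union, Finset.mem_image, Finset.mem_univ, true_and,
    Sym2.eq_iff]
  refine or_congr ⟨?_, ?_⟩ Iff.rfl
  · rintro ⟨l, ⟨rfl, rfl⟩ | ⟨rfl, rfl⟩⟩ <;> rfl
  · rintro rfl
    exact ⟨i, by simp⟩

lemma card_diagUnion {r : ℕ} {x y : Fin r → Fin n} (hlt : ∀ t, x t < y t)
    (hx : Function.Injective x) : (diagUnion x y).card = n + r := by
  rw [diagUnion, Finset.card_union_of_disjoint, Finset.card_image_of_injective,
    Finset.card_image_of_injective, Finset.card_fin, Finset.card_fin]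
  · intro s t h
    rcases Sym2.eq_iff.1 h with h | h
    · exact hx h.1
    · have h1 := hlt s
      have h2 := hlt t
      rw [h.1, h.2] at h1
      exact absurd h1 h2.asymm
  · intro i j h
    simpa using h
  · rw [Finset.disjoint_left]
    intro e he he'
    obtain ⟨i, -, rfl⟩ := Finset.mem_image.1 he
    obtain ⟨t, -, ht⟩ := Finset.mem_image.1 he'
    have := hlt t
    rcases Sym2.eq_iff.1 ht with h | h <;> simp [h.1, h.2] at this

/-- The graph with the `r` disjoint edges `{2 j, 2 j + 1}`, `j < r`. With `d = n / 2 - 1`, the blocks are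
the union `{0, 1, 2, 3}` of two edges and the pairs `{2 j, 2 j + 1}` with `j ≥ 2`; if `n` is odd, the
last vertex is added to the block `{4, 5}`, which is an edge. -/
theorem exists_of_matching [NeZero (2 : k)] {r : ℕ} (hr : 2 ≤ r) (hrn : 2 * r ≤ n)
    (hpar : Even n ∨ 3 ≤ r) :
    ∃ D : Finset (Sym2 (Fin n)), (∀ i, s(i, i) ∈ D) ∧ D.card = n + r ∧
      ¬ HasWLP (quadIdeal k D) := by
  let x : Fin r → Fin n := fun t => ⟨2 * t.1, by omega⟩
  let y : Fin r → Fin n := fun t => ⟨2 * t.1 + 1, by omega⟩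
  have hD : ∀ i j : Fin n, s(i, j) ∈ diagUnion x y ↔
      i = j ∨ i.1 / 2 = j.1 / 2 ∧ i.1 / 2 < r := by
    intro i j
    rw [mk_mem_diagUnion]
    constructor
    · rintro (h | ⟨t, ⟨rfl, rfl⟩ | ⟨rfl, rfl⟩⟩)
      · exact Or.inl h
      all_goals right; simp only [x, y]; omega
    · rintro (h | ⟨h1, h2⟩)
      · exact Or.inl h
      · by_cases hij : i = j
        · exact Or.inl hij
        · refine Or.inr ⟨⟨i.1 / 2, h2⟩, ?_⟩
          simp only [x, y, Fin.ext_iff] at hij ⊢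
          omega
  have hpar' : n % 2 = 0 ∨ 3 ≤ r := by rwa [Nat.even_iff] at hpar
  refine ⟨diagUnion x y, fun i => (hD i i).2 (Or.inl rfl),
    card_diagUnion (fun t => by simp [x, y, Fin.lt_def]) (fun s t h => by
      simp only [x, Fin.mk.injEq] at h; exact Fin.ext (by omega)), ?_⟩
  let b : Fin n → Fin (n / 2 - 1) := fun i =>
    ⟨if i.1 = n - 1 ∧ n % 2 = 1 then 1 else i.1 / 2 - 1, by split_ifs <;> omega⟩
  -- the sign separates the two edges in `{0, 1, 2, 3}`, the edge `{4, 5}` from the last vertex (which is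
  -- even for odd `n`), and the two vertices of each remaining pair
  let σ : Fin n → Bool := fun i =>
    decide (if i.1 < 4 then i.1 / 2 = 1 else i.1 < 6 ∧ 3 ≤ r ∨ i.1 % 2 = 1)
  refine not_hasWLP_of_blocks b ?_ Set.univ σ ?_ ?_ (by omega) ?_
  · intro i j hij
    rcases (hD i j).1 hij with rfl | ⟨h1, h2⟩
    · rfl
    · simp only [b, Fin.mk.injEq]
      split_ifs <;> omega
  · intro i j _ hij hnot
    refine ⟨trivial, ?_⟩
    rw [hD, Fin.ext_iff] at hnot
    simp only [b, Fin.mk.injEq] at hij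
    simp only [σ, ne_eq, decide_eq_decide]
    split_ifs at hij ⊢ <;> omega
  · intro β
    refine ⟨⟨if β.1 = 0 then 0 else 2 * β.1 + 2, by split_ifs <;> omega⟩, trivial, ?_⟩
    simp only [b, Fin.ext_iff]
    split_ifs <;> omega
  · intro i j hij hi hj
    rcases (hD i j).1 hij with rfl | ⟨h1, h2⟩
    · rfl
    · exact h1

/-- The star with centre `n - 1` and leaves `0, …, r - 1`. The first block consists of the star, where
the centre is isolated in the graph of non-edges; the vertices `r, …, n - 2` are grouped in pairs,
the last of which may degenerate to a single vertex. The last block has index `(n - 2 - r) / 2 + 1`,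
so there are `1 + (n - r) / 2` blocks. -/
theorem exists_of_star [NeZero (2 : k)] {r : ℕ} (hr : 4 ≤ r) (hrn : r + 2 ≤ n)
    (hpar : Odd n ∨ 5 ≤ r) :
    ∃ D : Finset (Sym2 (Fin n)), (∀ i, s(i, i) ∈ D) ∧ D.card = n + r ∧
      ¬ HasWLP (quadIdeal k D) := by
  let x : Fin r → Fin n := fun t => ⟨t.1, by omega⟩
  let y : Fin r → Fin n := fun _ => ⟨n - 1, by omega⟩
  have hD : ∀ i j : Fin n, s(i, j) ∈ diagUnion x y ↔
      i = j ∨ i.1 < r ∧ j.1 = n - 1 ∨ j.1 < r ∧ i.1 = n - 1 := by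
    intro i j
    rw [mk_mem_diagUnion]
    constructor
    · rintro (h | ⟨t, ⟨rfl, rfl⟩ | ⟨rfl, rfl⟩⟩)
      exacts [Or.inl h, Or.inr (Or.inl ⟨t.2, rfl⟩), Or.inr (Or.inr ⟨t.2, rfl⟩)]
    · rintro (h | ⟨h1, h2⟩ | ⟨h1, h2⟩)
      · exact Or.inl h
      · exact Or.inr ⟨⟨i.1, h1⟩, Or.inl ⟨rfl, Fin.ext h2.symm⟩⟩
      · exact Or.inr ⟨⟨j.1, h1⟩, Or.inr ⟨rfl, Fin.ext h2.symm⟩⟩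
  have hpar' : n % 2 = 1 ∨ 5 ≤ r := by rwa [Nat.odd_iff] at hpar
  refine ⟨diagUnion x y, fun i => (hD i i).2 (Or.inl rfl),
    card_diagUnion (fun t => by simp only [x, y, Fin.lt_def]; omega) (fun s t h => by
      simp only [x, Fin.mk.injEq] at h; exact Fin.ext h), ?_⟩
  let b : Fin n → Fin (1 + (n - r) / 2) := fun i =>
    ⟨if i.1 = n - 1 ∨ i.1 < r then 0 else 1 + (i.1 - r) / 2, by split_ifs <;> omega⟩
  refine not_hasWLP_of_blocks b ?_ {i | r ≤ i.1} (fun i => decide ((i.1 - r) % 2 = 0))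
    ?_ ?_ (by omega) ?_
  · intro i j hij
    rcases (hD i j).1 hij with rfl | h
    · rfl
    · simp only [b, Fin.mk.injEq]
      split_ifs <;> omega
  · intro i j hi hij hnot
    rw [hD, Fin.ext_iff] at hnot
    simp only [b, Fin.mk.injEq] at hij
    simp only [Set.mem_ofPred_eq, ne_eq, decide_eq_decide] at hi ⊢
    split_ifs at hij <;> omega
  · intro β
    refine ⟨⟨if β.1 = 0 then n - 1 else r + 2 * (β.1 - 1), by split_ifs <;> omega⟩, ?_, ?_⟩
    · simp only [Set.mem_ofPred_eq]
      split_ifs <;> omega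
    · simp only [b, Fin.ext_iff]
      split_ifs <;> omega
  · intro i j hij hi hj
    rcases (hD i j).1 hij with rfl | h
    · rfl
    · omega

/-- Here `n - 1` is joined to all other vertices, so that a single block suffices and `d = 1`. Any set
of further edges is allowed, except the four joining `{0, 1}` to `{2, 3}`. -/
theorem exists_of_cone [NeZero (2 : k)] {μ : ℕ} (hn : 5 ≤ n) (hμ : 2 * n - 1 ≤ μ)
    (hμ' : μ ≤ n.choose 2) :
    ∃ D : Finset (Sym2 (Fin n)), (∀ i, s(i, i) ∈ D) ∧ D.card = μ ∧
      ¬ HasWLP (quadIdeal k D) := by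
  let x : Fin (n - 1) → Fin n := fun t => ⟨t.1, by omega⟩
  let y : Fin (n - 1) → Fin n := fun _ => ⟨n - 1, by omega⟩
  let P : Finset (Sym2 (Fin n)) :=
    {s(⟨0, by omega⟩, ⟨2, by omega⟩), s(⟨0, by omega⟩, ⟨3, by omega⟩),
      s(⟨1, by omega⟩, ⟨2, by omega⟩), s(⟨1, by omega⟩, ⟨3, by omega⟩)}
  have hsub : diagUnion x y ⊆ Finset.univ \ P := by
    intro e he
    induction e with | _ i j
    rw [mk_mem_diagUnion] at he
    simp only [P, Finset.mem_sdiff, Finset.mem_univ, true_and, Finset.mem_insert,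
      Finset.mem_singleton, Sym2.eq_iff, Fin.ext_iff, x, y] at he ⊢
    rcases he with h | ⟨t, h⟩ <;> omega
  have hcard : (diagUnion x y).card = n + (n - 1) :=
    card_diagUnion (fun t => by simp only [x, y, Fin.lt_def]; omega) (fun s t h => by
      simp only [x, Fin.mk.injEq] at h; exact Fin.ext h)
  have hcard' : n.choose 2 ≤ (Finset.univ \ P).card := by
    have h1 : P.card ≤ 4 := Finset.card_le_four
    have h2 := Finset.le_card_sdiff P Finset.univ
    have h3 : (n + 1).choose 2 = n + n.choose 2 := by
      rw [Nat.choose_succ_succ' n 1, Nat.choose_one_right]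
    rw [Finset.card_univ, Sym2.card, Fintype.card_fin] at h2
    omega
  obtain ⟨D, hLD, hDU, hDμ⟩ := Finset.exists_subsuperset_card_eq hsub
    (by omega : (diagUnion x y).card ≤ μ) (hμ'.trans hcard')
  have hstar : ∀ i : Fin n, s(i, ⟨n - 1, by omega⟩) ∈ D := by
    intro i
    refine hLD (mk_mem_diagUnion.2 ?_)
    by_cases hi : i.1 = n - 1
    · exact Or.inl (Fin.ext hi)
    · exact Or.inr ⟨⟨i.1, by omega⟩, Or.inl ⟨rfl, rfl⟩⟩
  refine ⟨D, fun i => hLD (mk_mem_diagUnion.2 (Or.inl rfl)), hDμ, ?_⟩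
  refine not_hasWLP_of_blocks (d := 1) (fun _ => 0) (fun _ _ _ => rfl) {⟨n - 1, by omega⟩}
    (fun _ => true) ?_ ?_ (by omega) ?_
  · rintro i j rfl - hnot
    exact absurd (Sym2.eq_swap ▸ hstar j) hnot
  · intro β
    exact ⟨_, rfl, Subsingleton.elim _ _⟩
  · intro i j hij hi hj
    have := hDU hij
    simp only [P, Finset.mem_sdiff, Finset.mem_univ, true_and, Finset.mem_insert,
      Finset.mem_singleton, Sym2.eq_iff, Fin.ext_iff] at this
    omega

/-- The numerical conditions are those that hold for all `μ ∈ Ω_n`. -/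
theorem exists_not_hasWLP [NeZero (2 : k)] {μ : ℕ} (h2 : n + 2 ≤ μ) (hle : μ ≤ n.choose 2)
    (h4 : 4 ≤ n) (hn4 : n = 4 → μ ≤ 6) (hn5 : n = 5 → 9 ≤ μ) (hn6 : n = 6 → μ ≠ 10)
    (hodd : Odd n → n + 3 ≤ μ) :
    ∃ D : Finset (Sym2 (Fin n)), (∀ i, s(i, i) ∈ D) ∧ D.card = μ ∧
      ¬ HasWLP (quadIdeal k D) := by
  obtain ⟨r, rfl⟩ := Nat.exists_eq_add_of_le (Nat.le_of_add_right_le h2)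
  rw [Nat.odd_iff] at hodd
  by_cases hc : 5 ≤ n ∧ 2 * n - 1 ≤ n + r
  · exact exists_of_cone hc.1 hc.2 hle
  by_cases hr : 4 ≤ r ∧ (n % 2 = 1 ∨ 5 ≤ r)
  · exact exists_of_star hr.1 (by omega) (by rw [Nat.odd_iff]; exact hr.2)
  · exact exists_of_matching (by omega) (by omega) (by rw [Nat.even_iff]; omega)

end

theorem proposition4p11 {k : Type*} [Field k] [CharZero k] (n : ℕ) (hn : 4 ≤ n)
    (μ : ℕ) (hμ : μ ∈ Omega k n) :
    ∃ I : Ideal (MvPolynomial (Fin n) k),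
      IsMinimallyGeneratedByMonomials I 2 μ ∧
      IsArtinianRing (MvPolynomial (Fin n) k ⧸ I) ∧
      ¬ HasWLP I := by
  suffices h : ∃ D : Finset (Sym2 (Fin n)), (∀ i, s(i, i) ∈ D) ∧ D.card = μ ∧
      ¬ HasWLP (quadIdeal k D) by
    obtain ⟨D, hdiag, rfl, hD⟩ := h
    exact ⟨_, isMinimallyGenerated_quadIdeal D, isArtinianRing_quotient_quadIdeal hdiag, hD⟩
  have hΔ : (μ : ℤ) ≤ Delta k n 2 → μ ≤ n.choose 2 := fun h => by
    exact_mod_cast h.trans Delta_two_le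
  rw [Omega] at hμ
  split_ifs at hμ with c4 c5 c6 c7 c8
  · subst c4
    have hle := hΔ hμ.2
    have h6 : Nat.choose 4 2 = 6 := rfl
    exact exists_not_hasWLP hμ.1 hle hn (by omega) (by omega) (by omega)
      (fun h => absurd h (by decide))
  · subst c5
    have h9 := hμ.1
    exact exists_not_hasWLP (by omega) (hΔ hμ.2) hn (by omega) (fun _ => h9) (by omega)
      (fun _ => by omega)
  · subst c6
    exact exists_not_hasWLP hμ.1.1 (hΔ hμ.1.2) hn (by omega) (by omega) (fun _ => hμ.2)
      (fun h => absurd h (by decide))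
  · have h3 := hμ.1
    exact exists_not_hasWLP (by omega) (hΔ hμ.2) hn (by omega) (by omega) (by omega)
      (fun _ => h3)
  · exact exists_not_hasWLP hμ.1 (hΔ hμ.2) hn (by omega) (by omega) (by omega)
      (fun h => absurd c8.2 (Nat.not_even_iff_odd.2 h))
  · exact hμ.elim
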